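/- Let $X=\omega^\omega$, $\omega=\{0,1,2,\dots\}$, with the product topology and the compatible complete metric $\rho(x,y)=2^{-\min\{m\,:\,x(m)\ne y(m)\}}$ for $x\neq y$, and let $T\colon X\to X$, $(Tx)(n)=x(n+1)$, be the shift. Let $\mathcal M(X)$ be the space of Borel probability measures on $X$ with the weak$^*$ topology (tested on bounded continuous functions), and $\mathcal M_T(X)\subseteq\mathcal M(X)$ the set of $T$-invariant ones. For $x\in X$ and $n\ge1$ put $\mathcal E(x,n)=\frac1n\sum_{i<n}\delta_{T^i x}$, and let $V(x)\subseteq\mathcal M(X)$ be the set of all limit points of the sequence $(\mathcal E(x,n))_{n\ge1}$. For $V\subseteq\mathcal M(X)$ put $$G^V=\{x: V\subseteq V(x)\},\quad G_V=\{x: V(x)\subseteq V\},\quad G(V)=G^V\cap G_V,\quad {}^{V}G=\{x: V(x)\cap V\ne\emptyset\}.$$ A set is $\boldsymbol\Sigma^1_1$ if it is analytic and $\boldsymbol\Pi^1_1$ if its complement is analytic. For $\boldsymbol\Gamma\in\{\boldsymbol\Sigma^1_1,\boldsymbol\Pi^1_1\}$ a set $A\subseteq X$ is $\boldsymbol\Gamma$-complete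 if $A\in\boldsymbol\Gamma$ and for every zero-dimensional Polish space $Y$ and every $B\subseteq Y$ in $\boldsymbol\Gamma$ there is a continuous $f\colon Y\to X$ with $f^{-1}(A)=B$. The map $T$ has the specification property if for every $\varepsilon>0$ there is $N\in\omega$ such that for all $k\ge1$, $x_1,\dots,x_k\in X$ and $n_1,\dots,n_k\ge1$ there are $y\in X$ and gaps $s_1,\dots,s_{k-1}\in\{0,\dots,N\}$ with $\rho\bigl(T^{\sum_{i<j}(n_i+s_i)+t}(y),T^t(x_j)\bigr)<\varepsilon$ for all $1\le j\le k$ and $0\le t<n_j$. **Theorem.** $(X,T)$ is a Polish dynamical system (that is, $X$ is Polish and $T$ is continuous) with the specification property. Let $\mu=\delta_{\bar 0}$ be the Dirac measure at the zero sequence, $V=\{\mu\}$ and $U=\mathcal M_T(X)\setminus\{\mu\}$. Then $V$ is a closed, connected, nonempty subset of $\mathcal M_T(X)$, and 1. $G(V)$ is $\boldsymbol\Pi^1_1$-complete, and it is not $\boldsymbol\Sigma^1_1$; 2. $G_V$ is $\boldsymbol\Pi^1_1$-complete, and it is not $\boldsymbol\Sigma^1_1$; 3. ${}^{U}G$ is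 $\boldsymbol\Sigma^1_1$-complete, and it is not $\boldsymbol\Pi^1_1$. In particular, none of the three sets is Borel. -/

import Mathlib

open MeasureTheory Filter Topology TopologicalSpace
open scoped ENNReal

namespace NonCompactGeneric

noncomputable section

/-! ### Coanalytic sets and completeness -/

/-- A set is coanalytic (`Π¹₁`) if its complement is analytic (`Σ¹₁`). -/
def CoanalyticSet {X : Type*} [TopologicalSpace X] (A : Set X) : Prop :=
  AnalyticSet Aᶜ

/-- `B ⊆ Y` is continuously (Wadge) reducible to `A ⊆ X`. -/
def ContinuouslyReducible {Y X : Type*} [TopologicalSpace Y] [TopologicalSpace X]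
    (B : Set Y) (A : Set X) : Prop :=
  ∃ f : Y → X, Continuous f ∧ f ⁻¹' A = B

/-- `A` is `Σ¹₁`-complete: it is analytic, and every analytic subset of every zero-dimensional
Polish space is continuously reducible to it. -/
def IsSigmaOneOneComplete {X : Type*} [TopologicalSpace X] (A : Set X) : Prop :=
  AnalyticSet A ∧
    ∀ (Y : Type) [TopologicalSpace Y] [PolishSpace Y],
      IsTopologicalBasis {s : Set Y | IsClopen s} →
        ∀ B : Set Y, AnalyticSet B → ContinuouslyReducible B A

/-- `A` is `Π¹₁`-complete: it is coanalytic, and every coanalytic subset of every zero-dimensional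
Polish space is continuously reducible to it. -/
def IsPiOneOneComplete {X : Type*} [TopologicalSpace X] (A : Set X) : Prop :=
  CoanalyticSet A ∧
    ∀ (Y : Type) [TopologicalSpace Y] [PolishSpace Y],
      IsTopologicalBasis {s : Set Y | IsClopen s} →
        ∀ B : Set Y, CoanalyticSet B → ContinuouslyReducible B A

/-! ### The specification property -/

/-- The point `y` traces `ε`-close, with gaps `s`, the specification
`⟨x₀, n₀⟩, …, ⟨x_{k-1}, n_{k-1}⟩`. The gap `s j` stands between segment `j` and segment `j + 1`;
the value of `s` at the last index is irrelevant. -/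
def Traces {X : Type*} [MetricSpace X] (T : X → X) (ε : ℝ) {k : ℕ}
    (x : Fin k → X) (n : Fin k → ℕ) (s : Fin k → ℕ) (y : X) : Prop :=
  ∀ j : Fin k, ∀ t < n j,
    dist (T^[(∑ i ∈ Finset.Iio j, (n i + s i)) + t] y) (T^[t] (x j)) < ε

/-- The specification property of `T` (with respect to the metric of `X`). -/
def SpecificationProperty (X : Type*) [MetricSpace X] (T : X → X) : Prop :=
  ∀ ε : ℝ, 0 < ε → ∃ N : ℕ, ∀ k : ℕ, 0 < k →
    ∀ (x : Fin k → X) (n : Fin k → ℕ), (∀ j, 0 < n j) →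
      ∃ (y : X) (s : Fin k → ℕ), (∀ j, s j ≤ N) ∧ Traces T ε x n s y

/-! ### Empirical measures and the sets they define -/

section Generic

variable {X : Type*} [MeasurableSpace X]

/-- The empirical measure `(δ_x + δ_{T x} + ⋯ + δ_{T^{n-1} x}) / n`, for `n ≥ 1`. -/
def empiricalMeasure (T : X → X) (x : X) (n : ℕ) (hn : n ≠ 0) : ProbabilityMeasure X :=
  ⟨(n : ℝ≥0∞)⁻¹ • ∑ i ∈ Finset.range n, Measure.dirac (T^[i] x), ⟨by
    simp [ENNReal.inv_mul_cancel, hn]⟩⟩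

/-- The set `M_T(X)` of `T`-invariant Borel probability measures, as a subset of the space of all
Borel probability measures. -/
def invariantMeasures (T : X → X) : Set (ProbabilityMeasure X) :=
  {μ | ∀ A : Set X, MeasurableSet A → μ (T ⁻¹' A) = μ A}

variable [TopologicalSpace X] [OpensMeasurableSpace X]

/-- `V(x)`: the set of all limit points, in the weak* topology, of the sequence of empirical
measures of `x`, indexed by the positive integers `n + 1`. -/
def limitMeasures (T : X → X) (x : X) : Set (ProbabilityMeasure X) :=
  {μ | MapClusterPt μ atTop (fun n : ℕ => empiricalMeasure T x (n + 1) n.succ_ne_zero)}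

/-- `G^V = {x | V ⊆ V(x)}`. -/
def upperG (T : X → X) (V : Set (ProbabilityMeasure X)) : Set X :=
  {x | V ⊆ limitMeasures T x}

/-- `G_V = {x | V(x) ⊆ V}`. -/
def lowerG (T : X → X) (V : Set (ProbabilityMeasure X)) : Set X :=
  {x | limitMeasures T x ⊆ V}

/-- `G(V) = G^V ∩ G_V`. -/
def genericG (T : X → X) (V : Set (ProbabilityMeasure X)) : Set X :=
  upperG T V ∩ lowerG T V

/-- `^V G = {x | V(x) ∩ V ≠ ∅}`. -/
def hitG (T : X → X) (V : Set (ProbabilityMeasure X)) : Set X :=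
  {x | (limitMeasures T x ∩ V).Nonempty}

end Generic

/-! ### The shift on `ω^ω` -/

/-- The shift map on `ω^ω`. -/
def shift (x : ℕ → ℕ) : ℕ → ℕ := fun n => x (n + 1)

/-- The Dirac measure at the zero sequence. -/
def deltaZero : ProbabilityMeasure (ℕ → ℕ) :=
  ⟨Measure.dirac (fun _ => 0), inferInstance⟩

/-- The usual metric on `ω^ω`: `ρ(x, y) = 2^{-m}` if `x ≠ y` and `m` is the least index with
`x m ≠ y m`. -/
abbrev baireMetric : MetricSpace (ℕ → ℕ) := PiNat.metricSpaceNatNat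

end

end NonCompactGeneric

/-!
Analytic sets are projections of closed sets, so an analytic subset of a zero-dimensional Polish
space is the set of points `y` whose tree `T y` of finite sequences has a branch, for a suitable
family of trees depending continuously on `y`. A tree `T` is coded by a point of Baire space which
vanishes outside the blocks `[n!, 2 * n!)`, where `n` is the number of a node `s` of `T`; there it
takes the values `s m + 1`, each with frequency `2 ^ (-(m + 1))`. Since `n!` is negligible compared
with `(n + 1)!`, an empirical measure only sees the last block before its time.

By Prokhorov's theorem and shift invariance, a point has a limit measure other than the Dirac
measure at zero if and only if, along some sequence of times, its nonzero symbols have frequency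
bounded away from zero while no mass escapes to infinity. For the point coding `T` the first
condition says that the times stay within or shortly after blocks of nodes of `T`; the second one
says that at each position `m` these nodes have boundedly many symbols, so that by compactness they
accumulate at a branch of `T`. The Dirac measure at zero is always a limit measure, seen at the
times `n!`, so the same coding handles all three sets.
-/

namespace NonCompactGeneric

open scoped Nat

/-! ### Analytic sets -/

section Analytic

variable {X : Type*} [TopologicalSpace X]

lemma exists_isClosed_image_fst_eq [T2Space X] {A : Set X} (hA : AnalyticSet A) :
    ∃ F : Set (X × (ℕ → ℕ)), IsClosed F ∧ Prod.fst '' F = A := by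
  rw [AnalyticSet] at hA
  obtain rfl | ⟨f, hf, rfl⟩ := hA
  · exact ⟨∅, isClosed_empty, Set.image_empty _⟩
  · exact ⟨{p | f p.2 = p.1}, isClosed_eq (hf.comp continuous_snd) continuous_fst,
      by ext x; simp⟩

lemma exists_seq_isOpen_forall_eq_iUnion (X : Type*) [TopologicalSpace X]
    [SecondCountableTopology X] :
    ∃ b : ℕ → Set X, (∀ n, IsOpen (b n)) ∧
      ∀ U, IsOpen U → ∃ z : ℕ → ℕ, U = ⋃ n, b (z n) := by
  obtain ⟨b, hb⟩ := ((countable_countableBasis X).insert ∅).exists_eq_range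
    (Set.insert_nonempty _ _)
  refine ⟨b, fun n => ?_, fun U hU => ?_⟩
  · obtain h | h : b n ∈ insert ∅ (countableBasis X) := hb ▸ Set.mem_range_self n
    · exact h ▸ isOpen_empty
    · exact (isBasis_countableBasis X).isOpen h
  · obtain ⟨S, hS, rfl⟩ := (isBasis_countableBasis X).open_eq_sUnion hU
    obtain ⟨s, hs⟩ := (((countable_countableBasis X).mono hS).insert ∅).exists_eq_range
      (Set.insert_nonempty _ _)
    have hsb : ∀ n, ∃ k, b k = s n := fun n => by
      rw [← Set.mem_range, ← hb]
      exact Set.insert_subset_insert hS (hs ▸ Set.mem_range_self n)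
    choose z hz using hsb
    exact ⟨z, by simp only [hz, ← Set.sUnion_range, ← hs, Set.sUnion_insert, Set.empty_union]⟩

/- Cantor's diagonal argument: with `z` ranging over codes of open sets `⋃ n, b (z n)` of the plane,
the diagonal of the universal analytic set differs from the complement of every analytic set. -/
lemma exists_analyticSet_not_coanalyticSet :
    ∃ D : Set (ℕ → ℕ), AnalyticSet D ∧ ¬ CoanalyticSet D := by
  obtain ⟨b, hb, hsurj⟩ := exists_seq_isOpen_forall_eq_iUnion ((ℕ → ℕ) × (ℕ → ℕ))
  let F : Set ((ℕ → ℕ) × (ℕ → ℕ)) := {p | ∀ n, p ∉ b (p.1 n)}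
  have hF : IsClosed F := by
    have hopen (n : ℕ) : IsOpen {p : (ℕ → ℕ) × (ℕ → ℕ) | p ∈ b (p.1 n)} := by
      have heq : {p : (ℕ → ℕ) × (ℕ → ℕ) | p ∈ b (p.1 n)} =
          ⋃ m, {p | p.1 n = m} ∩ b m := by
        ext p
        simp
      have hcont : Continuous fun p : (ℕ → ℕ) × (ℕ → ℕ) => p.1 n := by fun_prop
      rw [heq]
      exact isOpen_iUnion fun m => ((isOpen_discrete {m}).preimage hcont).inter (hb m)
    rw [← isOpen_compl_iff]
    convert isOpen_iUnion hopen using 1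
    ext p
    simp [F]
  refine ⟨Prod.fst '' F, hF.analyticSet.image_of_continuous continuous_fst, fun hD => ?_⟩
  obtain ⟨F', hF', hF'D⟩ := exists_isClosed_image_fst_eq hD
  obtain ⟨z, hz⟩ := hsurj F'ᶜ hF'.isOpen_compl
  have hmem (α : ℕ → ℕ) : (z, α) ∈ F' ↔ (z, α) ∈ F := by
    rw [← not_iff_not, ← Set.mem_compl_iff, hz]
    simp [F]
  have hiff : z ∈ Prod.fst '' F ↔ z ∈ (Prod.fst '' F)ᶜ := by
    rw [← hF'D]
    simp [hmem]
  exact iff_not_self hiff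

lemma IsSigmaOneOneComplete.not_coanalyticSet [T2Space X] {A : Set X}
    (hA : IsSigmaOneOneComplete A) : ¬ CoanalyticSet A := fun h => by
  obtain ⟨D, hD, hDc⟩ := exists_analyticSet_not_coanalyticSet
  obtain ⟨f, hf, rfl⟩ := hA.2 (ℕ → ℕ) isTopologicalBasis_clopens D hD
  exact hDc (AnalyticSet.preimage h hf)

lemma IsPiOneOneComplete.not_analyticSet [T2Space X] {A : Set X}
    (hA : IsPiOneOneComplete A) : ¬ AnalyticSet A := fun h => by
  obtain ⟨D, hD, hDc⟩ := exists_analyticSet_not_coanalyticSet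
  obtain ⟨f, hf, hfD⟩ := hA.2 (ℕ → ℕ) isTopologicalBasis_clopens Dᶜ
    (by rwa [CoanalyticSet, compl_compl])
  rw [CoanalyticSet, ← hfD] at hDc
  exact hDc (h.preimage hf)

lemma IsPiOneOneComplete.not_measurableSet [PolishSpace X] {A : Set X}
    (hA : IsPiOneOneComplete A) : ¬ MeasurableSet[borel X] A := fun h => by
  borelize X
  exact hA.not_analyticSet h.analyticSet

lemma IsSigmaOneOneComplete.not_measurableSet [PolishSpace X] {A : Set X}
    (hA : IsSigmaOneOneComplete A) : ¬ MeasurableSet[borel X] A := fun h => by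
  borelize X
  exact hA.not_coanalyticSet h.compl.analyticSet

end Analytic

/-! ### Trees and branches -/

/-- A tree has a branch if some infinite sequence has all its finite initial segments in the tree,
that is, if the tree is ill-founded. -/
def HasBranch {A : Type*} (T : Descriptive.tree A) : Prop :=
  ∃ α : ℕ → A, ∀ n, (List.range n).map α ∈ T

lemma exists_continuous_injective_of_isTopologicalBasis_isClopen {Y : Type*} [TopologicalSpace Y]
    [SecondCountableTopology Y] [T0Space Y] (hY : IsTopologicalBasis {s : Set Y | IsClopen s}) :
    ∃ e : Y → ℕ → ℕ, Continuous e ∧ Function.Injective e := by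
  classical
  obtain ⟨B, hBclopen, hBcount, hB⟩ := hY.exists_countable
  obtain ⟨c, hc⟩ := (hBcount.insert ∅).exists_eq_range (Set.insert_nonempty _ _)
  have hclopen (n : ℕ) : IsClopen (c n) := by
    obtain h | h : c n ∈ insert ∅ B := hc ▸ Set.mem_range_self n
    · exact h ▸ isClopen_empty
    · exact hBclopen h
  refine ⟨fun y n => (c n).indicator 1 y, continuous_pi fun n =>
    (continuous_const (y := 1)).indicator (by simp [(hclopen n).frontier_eq]), fun y z hyz => ?_⟩
  refine hB.eq_iff.2 fun s hs => ?_
  obtain ⟨n, rfl⟩ : s ∈ Set.range c := hc ▸ Set.mem_insert_of_mem _ hs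
  have hn : (c n).indicator (1 : Y → ℕ) y = (c n).indicator 1 z := congrFun hyz n
  rw [← Set.indicator_eq_one_iff_mem ℕ, hn, Set.indicator_eq_one_iff_mem]

/-- The tree of a point `y` with respect to a parametrization `f` of an analytic set: its nodes
are the initial segments of those `β` for which `f β` and `y` are not yet told apart by the
coordinates of `e`. -/
def approximationTree {Y : Type*} (e : Y → ℕ → ℕ) (f : (ℕ → ℕ) → Y) (y : Y) :
    Descriptive.tree ℕ :=
  ⟨{v | ∃ β, (List.range v.length).map β = v ∧ ∀ i < v.length, e (f β) i = e y i}, by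
    rintro v a ⟨β, hβv, hβy⟩
    rw [List.length_append, List.length_singleton] at hβv hβy
    rw [List.range_succ, List.map_append] at hβv
    exact ⟨β, List.append_inj_left hβv (by simp), fun i hi => hβy i (by lia)⟩⟩

lemma hasBranch_approximationTree_iff {Y : Type*} [TopologicalSpace Y] {e : Y → ℕ → ℕ}
    (he : Continuous e) (he' : Function.Injective e) {f : (ℕ → ℕ) → Y} (hf : Continuous f) {y : Y} :
    HasBranch (approximationTree e f y) ↔ y ∈ Set.range f := by
  constructor
  · rintro ⟨α, hα⟩
    choose β hβα hβy using hα
    simp only [List.length_map, List.length_range] at hβα hβy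
    have hβ : Tendsto β atTop (𝓝 α) := by
      refine tendsto_pi_nhds.2 fun i => tendsto_const_nhds.congr' ?_
      filter_upwards [eventually_gt_atTop i] with n hn
      exact (List.map_inj_left.1 (hβα n) i (List.mem_range.2 hn)).symm
    have hefβ : Tendsto (fun n => e (f (β n))) atTop (𝓝 (e y)) := by
      refine tendsto_pi_nhds.2 fun i => tendsto_const_nhds.congr' ?_
      filter_upwards [eventually_gt_atTop i] with n hn
      exact (hβy n i hn).symm
    exact ⟨α, he' (tendsto_nhds_unique (((he.comp hf).tendsto α).comp hβ) hefβ)⟩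
  · rintro ⟨β, rfl⟩
    exact ⟨β, fun n => ⟨β, by simp, fun _ _ => rfl⟩⟩

lemma isClopen_setOf_mem_approximationTree {Y : Type*} [TopologicalSpace Y] {e : Y → ℕ → ℕ}
    (he : Continuous e) (f : (ℕ → ℕ) → Y) (v : List ℕ) :
    IsClopen {y | v ∈ approximationTree e f y} := by
  have hcont : Continuous fun y (i : Fin v.length) => e y i := by fun_prop
  let W : Set (Fin v.length → ℕ) :=
    {w | ∃ β, (List.range v.length).map β = v ∧ ∀ i : Fin v.length, e (f β) i = w i}
  convert (isClopen_discrete W).preimage hcont using 1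
  ext y
  simp only [W, Set.mem_preimage, Set.mem_ofPred_eq, Fin.forall_iff]
  rfl

lemma exists_tree_hasBranch_iff_mem {Y : Type*} [TopologicalSpace Y] [SecondCountableTopology Y]
    [T0Space Y] (hY : IsTopologicalBasis {s : Set Y | IsClopen s}) {B : Set Y}
    (hB : AnalyticSet B) :
    ∃ T : Y → Descriptive.tree ℕ, (∀ v, IsClopen {y | v ∈ T y}) ∧
      ∀ y, HasBranch (T y) ↔ y ∈ B := by
  rw [AnalyticSet] at hB
  obtain rfl | ⟨f, hf, rfl⟩ := hB
  · exact ⟨fun _ => ⊥, fun v => by simpa using isClopen_empty, fun y => by simp [HasBranch]⟩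
  · obtain ⟨e, he, he'⟩ := exists_continuous_injective_of_isTopologicalBasis_isClopen hY
    exact ⟨approximationTree e f, isClopen_setOf_mem_approximationTree he f,
      fun y => hasBranch_approximationTree_iff he he' hf⟩

lemma eventually_lt_length {A : Type*} {F : Filter (List A)} (hF : F ≤ cofinite)
    (hfin : ∀ m : ℕ, ∃ C : Set A, C.Finite ∧ ∀ᶠ s in F, ∀ a ∈ s[m]?, a ∈ C) (n : ℕ) :
    ∀ᶠ s in F, n < s.length := by
  choose C hC hFC using hfin
  have hD : (⋃ i ∈ Set.Iio n, C i).Finite := (Set.finite_Iio n).biUnion fun i _ => hC i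
  have := hD.to_subtype
  have hlists : {s : List A | s.length ≤ n ∧ ∀ a ∈ s, a ∈ ⋃ i ∈ Set.Iio n, C i}.Finite := by
    refine ((List.finite_length_le (⋃ i ∈ Set.Iio n, C i : Set A) n).image
      (List.map Subtype.val)).subset ?_
    rintro s ⟨hs, hsD⟩
    lift s to List (⋃ i ∈ Set.Iio n, C i : Set A) using hsD
    exact ⟨s, by simpa using hs, rfl⟩
  have hall : ∀ᶠ s in F, ∀ i ∈ Set.Iio n, ∀ a ∈ s[i]?, a ∈ C i :=
    (eventually_all_finite (Set.finite_Iio n)).2 fun i _ => hFC i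
  filter_upwards [hF hlists.compl_mem_cofinite, hall] with s hs hsC
  by_contra! hlen
  refine hs ⟨hlen, fun a ha => ?_⟩
  obtain ⟨i, hi⟩ := List.mem_iff_getElem?.1 ha
  have hin : i < n := (List.getElem?_eq_some_iff.1 hi).1.trans_le hlen
  exact Set.mem_biUnion hin (hsC i hin a hi)

/- A form of König's lemma: an ultrafilter finer than `F` picks one symbol at each position. -/
lemma hasBranch_of_eventually_mem {A : Type*} {T : Descriptive.tree A} {F : Filter (List A)}
    [NeBot F] (hF : F ≤ cofinite) (hT : ∀ᶠ s in F, s ∈ T)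
    (hfin : ∀ m : ℕ, ∃ C : Set A, C.Finite ∧ ∀ᶠ s in F, ∀ a ∈ s[m]?, a ∈ C) : HasBranch T := by
  let U := Ultrafilter.of F
  have hU : ↑U ≤ F := Ultrafilter.of_le F
  have hsymbol (m : ℕ) : ∃ a, ∀ᶠ s in (U : Filter (List A)), s[m]? = some a := by
    obtain ⟨C, hC, hFC⟩ := hfin m
    have hev : ∀ᶠ s in (U : Filter (List A)), ∃ a ∈ C, s[m]? = some a := by
      filter_upwards [hU hFC, hU (eventually_lt_length hF hfin m)] with s hs hm
      exact ⟨s[m], hs _ (List.getElem?_eq_getElem hm), List.getElem?_eq_getElem hm⟩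
    obtain ⟨a, -, ha⟩ := (Ultrafilter.eventually_exists_mem_iff hC).1 hev
    exact ⟨a, ha⟩
  choose α hα using hsymbol
  refine ⟨α, fun n => ?_⟩
  have hall : ∀ᶠ s in (U : Filter (List A)), ∀ i ∈ Set.Iio n, s[i]? = some (α i) :=
    (eventually_all_finite (Set.finite_Iio n)).2 fun i _ => hα i
  obtain ⟨s, hsT, hs⟩ := ((hT.filter_mono hU).and hall).exists
  have hinitial : (List.range n).map α <+: s := by
    rw [List.prefix_iff_getElem?]
    intro i hi
    simpa using hs i (by simpa using hi)
  exact Descriptive.Tree.mem_of_prefix hinitial hsT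

/-! ### Frequencies of symbols -/

/-- The number of `i < n` with `g < x i`. Divided by `n`, this is the mass that the empirical
measure of `x` under the shift gives to `{y | g < y 0}`. -/
def exceedances (g : ℕ) (x : ℕ → ℕ) (n : ℕ) : ℕ := Nat.count (fun i => g < x i) n

/-- No mass of the empirical measures of `x` at the times `M k + 1` escapes to infinity: the
frequency of the symbols above `g` is small, uniformly in `k`, for large `g`. -/
def IsTightAlong (x : ℕ → ℕ) (M : ℕ → ℕ) : Prop :=
  ∀ j, ∃ g, ∀ᶠ k in atTop, j * exceedances g x (M k + 1) ≤ M k + 1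

/-- Along some sequence of times, the nonzero symbols of `x` have frequency bounded away from zero
while no mass escapes to infinity. -/
def TightNonzero (x : ℕ → ℕ) : Prop :=
  ∃ M : ℕ → ℕ, Tendsto M atTop atTop ∧ IsTightAlong x M ∧
    ∃ q, ∀ᶠ k in atTop, M k + 1 ≤ q * exceedances 0 x (M k + 1)

/-- The ruler sequence `0, 1, 0, 2, 0, 1, 0, 3, …`, in which the value `m` has frequency
`2 ^ (-(m + 1))`. -/
def ruler (i : ℕ) : ℕ := padicValNat 2 (i + 1)

lemma le_ruler_iff {l i : ℕ} : l ≤ ruler i ↔ 2 ^ l ∣ i + 1 :=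
  (padicValNat_dvd_iff_le (p := 2) i.succ_ne_zero).symm

lemma count_le_ruler (l n : ℕ) : Nat.count (fun i => l ≤ ruler i) n = n / 2 ^ l := by
  simp only [Nat.count_eq_card_filter_range, le_ruler_iff, Nat.card_multiples]

lemma ruler_eq_of_modEq {m i : ℕ} (h : i + 1 ≡ 2 ^ m [MOD 2 ^ (m + 1)]) : ruler i = m := by
  refine le_antisymm (not_lt.1 fun hlt => ?_) (le_ruler_iff.2 ?_)
  · have hdvd : 2 ^ (m + 1) ∣ 2 ^ m := (h.dvd_iff dvd_rfl).1 (le_ruler_iff.1 hlt)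
    have hle := (Nat.pow_dvd_pow_iff_le_right (x := 2) (by norm_num)).1 hdvd
    lia
  · exact (h.dvd_iff (pow_dvd_pow 2 m.le_succ)).2 dvd_rfl

lemma div_le_count_add_modEq {r : ℕ} (hr : 0 < r) (a v n : ℕ) :
    n / r ≤ Nat.count (fun k => a + k ≡ v [MOD r]) n := by
  have hshift (k : ℕ) (hk : k ≡ v + a * (r - 1) [MOD r]) : a + k ≡ v [MOD r] := by
    have heq : a + (v + a * (r - 1)) = v + r * a := by
      obtain ⟨r, rfl⟩ := Nat.exists_eq_add_of_lt hr
      simp only [zero_add, Nat.add_sub_cancel]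
      ring
    have h := hk.add_left a
    rw [heq] at h
    simpa [Nat.ModEq] using h
  calc n / r ≤ Nat.count (· ≡ v + a * (r - 1) [MOD r]) n := by
        rw [Nat.count_modEq_card n hr]
        exact Nat.le_add_right _ _
    _ ≤ Nat.count (fun k => a + k ≡ v [MOD r]) n := Nat.count_mono_left fun k _ => hshift k

lemma div_le_count_ruler_eq (a m n : ℕ) :
    n / 2 ^ (m + 1) ≤ Nat.count (fun k => ruler (a + k) = m) n :=
  (div_le_count_add_modEq (by positivity) (a + 1) (2 ^ m) n).trans <|
    Nat.count_mono_left fun k _ hk => ruler_eq_of_modEq (by rwa [add_right_comm])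

/-- The number `n` of the block `[n!, (n + 1)!)` containing `i`; the junk value at `i = 0` is
`0`. -/
def stage (i : ℕ) : ℕ := Nat.findGreatest (fun n => n ! ≤ i) i

lemma stage_le_iff {n i : ℕ} : stage i ≤ n ↔ i < (n + 1)! := by
  constructor <;> intro h <;> by_contra! hlt
  · have hle : n + 1 ≤ stage i := Nat.le_findGreatest ((Nat.self_le_factorial _).trans hlt) hlt
    lia
  · have hspec : (stage i)! ≤ i := Nat.findGreatest_of_ne_zero (m := stage i) rfl (by lia)
    have hle := Nat.factorial_le (show n + 1 ≤ stage i from hlt)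
    lia

lemma succ_le_stage_iff {n i : ℕ} : n + 1 ≤ stage i ↔ (n + 1)! ≤ i := by
  rw [Nat.succ_le_iff, ← not_le, stage_le_iff, not_lt]

lemma factorial_stage_le {i : ℕ} (hi : 0 < i) : (stage i)! ≤ i := by
  cases h : stage i with
  | zero => exact hi
  | succ n => exact succ_le_stage_iff.1 h.ge

lemma stage_eq {n i : ℕ} (h₁ : n ! ≤ i) (h₂ : i < (n + 1)!) : stage i = n := by
  refine (stage_le_iff.2 h₂).antisymm ?_
  cases n with
  | zero => exact Nat.zero_le _
  | succ n => exact succ_le_stage_iff.2 h₁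

lemma tendsto_stage : Tendsto stage atTop atTop := by
  refine tendsto_atTop.2 fun n => ?_
  filter_upwards [eventually_ge_atTop (n + 1)!] with i hi
  exact (Nat.le_succ n).trans (succ_le_stage_iff.2 hi)

lemma count_le_add_count {p q : ℕ → Prop} [DecidablePred p] [DecidablePred q] {b n : ℕ}
    (h : ∀ i < n, p i → i < b ∨ q i) : Nat.count p n ≤ b + Nat.count q n := by
  simp only [Nat.count_eq_card_filter_range]
  rw [← Finset.card_range b]
  refine (Finset.card_le_card fun i hi => ?_).trans (Finset.card_union_le _ _)
  simp only [Finset.mem_filter, Finset.mem_range, Finset.mem_union] at hi ⊢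
  exact (h i hi.1 hi.2).imp_right (And.intro hi.1)

lemma count_le_of_forall_lt {p : ℕ → Prop} [DecidablePred p] {b n : ℕ}
    (h : ∀ i < n, p i → i < b) : Nat.count p n ≤ b := by
  simpa using count_le_add_count (q := fun _ => False) fun i hi hp => Or.inl (h i hi hp)

lemma exceedances_add (g : ℕ) (x : ℕ → ℕ) (m n : ℕ) :
    exceedances g x (m + n) = exceedances g x m + Nat.count (fun i => g < x (m + i)) n :=
  Nat.count_add _ _ _

/-! ### The point attached to a tree -/

/-- The `n`-th finite sequence in an enumeration of all of them. -/
def nthList (n : ℕ) : List ℕ := Denumerable.ofNat (List ℕ) n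

lemma nthList_injective : Function.Injective nthList :=
  (Denumerable.eqv (List ℕ)).symm.injective

lemma exists_nthList_eq (s : List ℕ) : ∃ n, nthList n = s :=
  ⟨Encodable.encode s, Denumerable.ofNat_encode s⟩

open Classical in
/-- The point of Baire space attached to a tree `T`. If the `n`-th finite sequence `s` belongs to
`T`, then the symbol `s m + 1` is used with frequency `2 ^ (-(m + 1))` on `[n!, 2 * n!)`, for
`m < s.length`; all other symbols are zero. -/
noncomputable def treePoint (T : Descriptive.tree ℕ) (i : ℕ) : ℕ :=
  if nthList (stage i) ∈ T ∧ i < 2 * (stage i)! then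
    ((nthList (stage i))[ruler i]?).elim 0 (· + 1)
  else 0

section TreePoint

variable {T : Descriptive.tree ℕ}

lemma continuous_treePoint {Y : Type*} [TopologicalSpace Y] {T : Y → Descriptive.tree ℕ}
    (hT : ∀ s, IsClopen {y | s ∈ T y}) : Continuous fun y => treePoint (T y) := by
  classical
  refine continuous_pi fun i => continuous_const.if (fun y hy => ?_) continuous_const
  have hclopen : IsClopen {y | nthList (stage i) ∈ T y ∧ i < 2 * (stage i)!} := by
    by_cases h : i < 2 * (stage i)! <;> simp [h, hT, isClopen_empty]
  simp [hclopen.frontier_eq] at hy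

lemma mem_and_lt_of_treePoint_pos {i : ℕ} (hi : 0 < treePoint T i) :
    nthList (stage i) ∈ T ∧ i < 2 * (stage i)! := by
  by_contra h
  simp [treePoint, h] at hi

lemma lt_two_mul_factorial_of_treePoint_pos {n i : ℕ} (hi : 0 < treePoint T i) (hin : i < n !) :
    i < 2 * (n - 1)! := by
  have hstage : stage i ≤ n - 1 :=
    stage_le_iff.2 (hin.trans_le (Nat.factorial_le (by lia)))
  exact (mem_and_lt_of_treePoint_pos hi).2.trans_le
    (Nat.mul_le_mul_left 2 (Nat.factorial_le hstage))

lemma treePoint_of_mem {n i : ℕ} (hT : nthList n ∈ T) (h₁ : n ! ≤ i) (h₂ : i < (n + 1)!)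
    (h₃ : i < 2 * n !) : treePoint T i = ((nthList n)[ruler i]?).elim 0 (· + 1) := by
  simp [treePoint, stage_eq h₁ h₂, hT, h₃]

lemma exceedances_treePoint_factorial_le (g n : ℕ) :
    exceedances g (treePoint T) n ! ≤ 2 * (n - 1)! :=
  count_le_of_forall_lt fun _ hi hg =>
    lt_two_mul_factorial_of_treePoint_pos (pos_of_gt hg) hi

lemma exceedances_treePoint_le {n r : ℕ} (hr : n ! + r ≤ (n + 1)!) (g : ℕ) :
    exceedances g (treePoint T) (n ! + r) ≤ 2 * (n - 1)! + min r n ! := by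
  rw [exceedances_add]
  refine add_le_add (exceedances_treePoint_factorial_le g n) (le_min (Nat.count_le _) ?_)
  refine count_le_of_forall_lt fun i hi hg => ?_
  have hlt := (mem_and_lt_of_treePoint_pos (pos_of_gt hg)).2
  rw [stage_eq (Nat.le_add_right _ _) (by lia : n ! + i < (n + 1)!)] at hlt
  lia

lemma exceedances_treePoint_le_of_notMem {n N : ℕ} (hT : nthList n ∉ T) (hN : N ≤ (n + 1)!)
    (g : ℕ) : exceedances g (treePoint T) N ≤ 2 * (n - 1)! := by
  refine count_le_of_forall_lt fun i hi hg => ?_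
  rcases lt_or_ge i n ! with hin | hin
  · exact lt_two_mul_factorial_of_treePoint_pos (pos_of_gt hg) hin
  · refine absurd ?_ hT
    rw [← stage_eq hin (hi.trans_le hN)]
    exact (mem_and_lt_of_treePoint_pos (pos_of_gt hg)).1

lemma div_le_exceedances_treePoint {n r m a g : ℕ} (hT : nthList n ∈ T)
    (hr : n ! + r ≤ (n + 1)!) (ha : (nthList n)[m]? = some a) (hg : g ≤ a) :
    min r n ! / 2 ^ (m + 1) ≤ exceedances g (treePoint T) (n ! + r) := by
  calc min r n ! / 2 ^ (m + 1)
      ≤ Nat.count (fun k => ruler (n ! + k) = m) (min r n !) := div_le_count_ruler_eq _ _ _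
    _ ≤ Nat.count (fun k => g < treePoint T (n ! + k)) (min r n !) :=
        Nat.count_mono_left fun k hk hm => by
          rw [treePoint_of_mem hT (by lia) (by lia) (by lia), hm, ha]
          exact Nat.lt_succ_of_le hg
    _ ≤ exceedances g (treePoint T) (n ! + r) := by
        rw [exceedances_add]
        exact le_add_left (Nat.count_monotone _ (min_le_left _ _))

lemma le_eight_mul_exceedances_treePoint {n a : ℕ} (hn : 2 ≤ n) (hT : nthList n ∈ T)
    (ha : (nthList n)[0]? = some a) :
    2 * n ! + 1 ≤ 8 * exceedances 0 (treePoint T) (2 * n ! + 1) := by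
  have hfact : 2 ≤ n ! := hn.trans (Nat.self_le_factorial n)
  have hle : n ! + (n ! + 1) ≤ (n + 1)! := by
    rw [Nat.factorial_succ]
    nlinarith
  have h := div_le_exceedances_treePoint hT hle ha (Nat.zero_le a)
  rw [min_eq_right (Nat.le_succ _), zero_add, pow_one, ← add_assoc, ← two_mul] at h
  lia

lemma mul_exceedances_treePoint_le {n j g : ℕ} (hn : 2 ≤ n) (hj : 4 * j ≤ n)
    (hT : nthList n ∈ T) (hg : ∀ m < 2 * j, ∀ a ∈ (nthList n)[m]?, a < g) :
    j * exceedances g (treePoint T) (2 * n ! + 1) ≤ 2 * n ! + 1 := by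
  have hle : 2 * n ! < (n + 1)! := by
    rw [Nat.factorial_succ]
    nlinarith [n.factorial_pos]
  have hsub : exceedances g (treePoint T) (2 * n ! + 1) ≤
      2 * (n - 1)! + (2 * n ! + 1) / 2 ^ (2 * j) := by
    rw [← count_le_ruler]
    refine count_le_add_count fun i hi hgi => ?_
    rcases lt_or_ge i n ! with hin | hin
    · exact .inl (lt_two_mul_factorial_of_treePoint_pos (pos_of_gt hgi) hin)
    · refine .inr (not_lt.1 fun hruler => ?_)
      have hstage : stage i = n := stage_eq hin (by lia)
      have hlt := (mem_and_lt_of_treePoint_pos (pos_of_gt hgi)).2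
      rw [hstage] at hlt
      rw [treePoint_of_mem hT hin (by lia) hlt] at hgi
      cases ha : (nthList n)[ruler i]? with
      | none => simp [ha] at hgi
      | some a =>
        have hag := hg _ hruler a ha
        simp only [ha, Option.elim_some] at hgi
        lia
  have hfact : 4 * j * (n - 1)! ≤ n ! := by
    rw [← Nat.mul_factorial_pred (by lia : n ≠ 0)]
    exact Nat.mul_le_mul_right _ hj
  have hdiv : 2 * j * ((2 * n ! + 1) / 2 ^ (2 * j)) ≤ 2 * n ! + 1 :=
    (Nat.mul_le_mul_right _ Nat.lt_two_pow_self.le).trans (Nat.mul_div_le _ _)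
  nlinarith [Nat.mul_le_mul_left (2 * j) hsub]

lemma tightNonzero_treePoint (hT : HasBranch T) : TightNonzero (treePoint T) := by
  obtain ⟨α, hα⟩ := hT
  choose n hn using fun k => exists_nthList_eq ((List.range k).map α)
  have hmem (k : ℕ) : nthList (n k) ∈ T := hn k ▸ hα k
  have hn_inj : Function.Injective n := fun k l hkl => by
    simpa [hn] using congrArg (List.length ∘ nthList) hkl
  have hn_top : Tendsto n atTop atTop := by
    simpa only [Nat.cofinite_eq_atTop] using hn_inj.tendsto_cofinite
  refine ⟨fun k => 2 * (n k)!, ?_, fun j => ?_, 8, ?_⟩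
  · exact tendsto_atTop_mono (fun k => by have := (n k).self_le_factorial; lia) hn_top
  · refine ⟨∑ m ∈ Finset.range (2 * j), (α m + 1), ?_⟩
    filter_upwards [hn_top.eventually_ge_atTop 2, hn_top.eventually_ge_atTop (4 * j)] with k h₂ h₄
    refine mul_exceedances_treePoint_le h₂ h₄ (hmem k) fun m hm a ha => ?_
    have ham : a = α m := by
      obtain ⟨i, hi, rfl⟩ : ∃ i, (List.range k)[m]? = some i ∧ α i = a := by
        simpa only [hn, List.getElem?_map, Option.mem_def, Option.map_eq_some_iff] using ha
      obtain ⟨_, rfl⟩ := List.getElem?_eq_some_iff.1 hi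
      rw [List.getElem_range]
    rw [ham]
    exact Finset.single_le_sum (f := fun m => α m + 1) (fun _ _ => Nat.zero_le _)
      (Finset.mem_range.2 hm)
  · filter_upwards [hn_top.eventually_ge_atTop 2, eventually_gt_atTop 0] with k h₂ hk
    exact le_eight_mul_exceedances_treePoint (a := α 0) h₂ (hmem k) (by simp [hn, hk])

lemma nthList_mem_of_le_mul_exceedances {q n r : ℕ} (hr : n ! + r < (n + 1)!) (hn : 4 * q < n)
    (hq : n ! + r ≤ q * exceedances 0 (treePoint T) (n ! + r)) :
    nthList n ∈ T ∧ n ! + r ≤ 2 * q * min r n ! := by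
  have hfact : 4 * q * (n - 1)! ≤ n ! := by
    rw [← Nat.mul_factorial_pred (by lia : n ≠ 0)]
    exact Nat.mul_le_mul_right _ hn.le
  constructor
  · by_contra hT
    have h := exceedances_treePoint_le_of_notMem hT hr.le 0
    nlinarith [n.factorial_pos, Nat.mul_le_mul_left q h]
  · have h := exceedances_treePoint_le (T := T) hr.le 0
    nlinarith [Nat.mul_le_mul_left q h]

lemma le_of_getElem?_nthList_eq_some {q g m a n r : ℕ} (hr : n ! + r < (n + 1)!)
    (hT : nthList n ∈ T) (hq : n ! + r ≤ 2 * q * min r n !)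
    (hg : 4 * q * 2 ^ (m + 1) * exceedances g (treePoint T) (n ! + r) ≤ n ! + r)
    (hn : 2 * q * 2 ^ (m + 1) ≤ n ! + r) (ha : (nthList n)[m]? = some a) : a ≤ g := by
  by_contra! hga
  have hdiv := div_le_exceedances_treePoint hT hr.le ha hga.le
  set E := exceedances g (treePoint T) (n ! + r)
  set D := 2 * q * 2 ^ (m + 1) with hD
  have hq0 : 0 < 2 * q := by
    have := n.factorial_pos
    by_contra! h0
    simp_all
  have hlt : n ! + r < D * (E + 1) := by
    calc n ! + r ≤ 2 * q * min r n ! := hq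
      _ < 2 * q * (2 ^ (m + 1) * (E + 1)) := by
        refine Nat.mul_lt_mul_of_pos_left ?_ hq0
        exact (Nat.lt_mul_div_succ _ (by positivity)).trans_le (Nat.mul_le_mul_left _ (by lia))
      _ = D * (E + 1) := by ring
  have hE : D * E < D := by
    have : 4 * q * 2 ^ (m + 1) * E = 2 * (D * E) := by rw [hD]; ring
    lia
  have hE0 : E = 0 := by
    by_contra h0
    nlinarith [Nat.pos_of_ne_zero h0]
  rw [hE0] at hlt
  lia

lemma hasBranch_of_tightNonzero (hx : TightNonzero (treePoint T)) : HasBranch T := by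
  obtain ⟨M, hM, htight, q, hq⟩ := hx
  let n : ℕ → ℕ := fun k => stage (M k + 1)
  have hn_top : Tendsto n atTop atTop := tendsto_stage.comp ((tendsto_add_atTop_nat 1).comp hM)
  have hblock (k : ℕ) : ∃ r, M k + 1 = (n k)! + r ∧ (n k)! + r < (n k + 1)! := by
    obtain ⟨r, hr⟩ := Nat.exists_eq_add_of_le (factorial_stage_le (M k).succ_pos)
    exact ⟨r, hr, hr ▸ stage_le_iff.1 le_rfl⟩
  choose r hMr hr using hblock
  have hmem : ∀ᶠ k in atTop, nthList (n k) ∈ T ∧ (n k)! + r k ≤ 2 * q * min (r k) (n k)! := by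
    filter_upwards [hq, hn_top.eventually_gt_atTop (4 * q)] with k hqk hnk
    exact nthList_mem_of_le_mul_exceedances (hr k) hnk (hMr k ▸ hqk)
  refine hasBranch_of_eventually_mem (F := map (fun k => nthList (n k)) atTop) ?_
    (eventually_map.2 (hmem.mono fun k hk => hk.1)) fun m => ?_
  · have hn_cofinite : Tendsto n atTop cofinite := by rwa [Nat.cofinite_eq_atTop]
    exact nthList_injective.tendsto_cofinite.comp hn_cofinite
  · obtain ⟨g, hg⟩ := htight (4 * q * 2 ^ (m + 1))
    refine ⟨Set.Iic g, Set.finite_Iic g, eventually_map.2 ?_⟩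
    filter_upwards [hmem, hg, hM.eventually_ge_atTop (2 * q * 2 ^ (m + 1))] with k hk hgk hMk a ha
    rw [hMr k] at hgk
    exact le_of_getElem?_nthList_eq_some (hr k) hk.1 hk.2 hgk (by have := hMr k; lia) ha

end TreePoint

/-! ### Limit measures of empirical measures -/

lemma isTightMeasureSet_pi {ι : Type*} [Countable ι] {E : ι → Type*}
    [∀ i, TopologicalSpace (E i)] [∀ i, MeasurableSpace (E i)] {S : Set (Measure (∀ i, E i))}
    (hS : ∀ i, IsTightMeasureSet ((fun μ => μ.map (Function.eval i)) '' S)) :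
    IsTightMeasureSet S := by
  rw [isTightMeasureSet_iff_exists_isCompact_measure_compl_le]
  intro ε hε
  obtain ⟨δ, hδ0, hδ⟩ := ENNReal.exists_pos_sum_of_countable hε.ne' ι
  have hcompact (i : ι) :
      ∃ K : Set (E i), IsCompact K ∧ ∀ μ ∈ S, μ (Function.eval i ⁻¹' Kᶜ) ≤ δ i := by
    obtain ⟨K, hK, hle⟩ := isTightMeasureSet_iff_exists_isCompact_measure_compl_le.1 (hS i) (δ i)
      (by exact_mod_cast hδ0 i)
    exact ⟨K, hK, fun μ hμ => (Measure.le_map_apply (measurable_pi_apply i).aemeasurable _).trans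
      (hle _ ⟨μ, hμ, rfl⟩)⟩
  choose K hK hle using hcompact
  refine ⟨Set.univ.pi K, isCompact_univ_pi hK, fun μ hμ => ?_⟩
  calc μ (Set.univ.pi K)ᶜ = μ (⋃ i, Function.eval i ⁻¹' (K i)ᶜ) := by
        congr 1
        ext y
        simp
    _ ≤ ∑' i, μ (Function.eval i ⁻¹' (K i)ᶜ) := measure_iUnion_le _
    _ ≤ ∑' i, (δ i : ℝ≥0∞) := ENNReal.tsum_le_tsum fun i => hle i μ hμ
    _ ≤ ε := hδ.le

lemma isTightMeasureSet_range_of_eventually_cofinite {ι X : Type*} [TopologicalSpace X]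
    [MeasurableSpace X] {ν : ι → Measure X} (hν : ∀ k, IsTightMeasureSet {ν k})
    (h : ∀ ε, 0 < ε → ∃ K, IsCompact K ∧ ∀ᶠ k in cofinite, ν k Kᶜ ≤ ε) :
    IsTightMeasureSet (Set.range ν) := by
  rw [isTightMeasureSet_iff_exists_isCompact_measure_compl_le]
  intro ε hε
  obtain ⟨K, hK, hKν⟩ := h ε hε
  have hcompact (k : ι) : ∃ L, IsCompact L ∧ ν k Lᶜ ≤ ε := by
    simpa using isTightMeasureSet_iff_exists_isCompact_measure_compl_le.1 (hν k) ε hε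
  choose L hL hLν using hcompact
  refine ⟨K ∪ ⋃ k ∈ {k | ¬ ν k Kᶜ ≤ ε}, L k, hK.union (hKν.isCompact_biUnion fun k _ => hL k), ?_⟩
  rintro _ ⟨k, rfl⟩
  by_cases hk : ν k Kᶜ ≤ ε
  · exact (measure_mono (Set.compl_subset_compl.2 Set.subset_union_left)).trans hk
  · refine (measure_mono (Set.compl_subset_compl.2 ?_)).trans (hLν k)
    exact (Set.subset_biUnion_of_mem (u := L) hk).trans Set.subset_union_right

lemma tendsto_measure_of_isClopen {X ι : Type*} [TopologicalSpace X] [MeasurableSpace X]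
    [OpensMeasurableSpace X] [HasOuterApproxClosed X] {l : Filter ι} {ν : ι → ProbabilityMeasure X}
    {μ : ProbabilityMeasure X} (hν : Tendsto ν l (𝓝 μ)) {A : Set X} (hA : IsClopen A) :
    Tendsto (fun k => (ν k : Measure X) A) l (𝓝 ((μ : Measure X) A)) :=
  ProbabilityMeasure.tendsto_measure_of_null_frontier_of_tendsto' hν (by simp [hA.frontier_eq])

lemma measure_mem_of_mapClusterPt {X ι : Type*} [TopologicalSpace X] [MeasurableSpace X]
    [OpensMeasurableSpace X] [HasOuterApproxClosed X] {l : Filter ι} {ν : ι → ProbabilityMeasure X}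
    {μ : ProbabilityMeasure X} (hμ : MapClusterPt μ l ν) {A : Set X} (hA : IsClopen A)
    {C : Set ℝ≥0∞} (hC : IsClosed C) (h : ∀ᶠ k in l, (ν k : Measure X) A ∈ C) :
    (μ : Measure X) A ∈ C := by
  let Φ : ProbabilityMeasure X → ℝ≥0∞ := fun ν => (ν : Measure X) A
  have hΦ : ContinuousAt Φ μ := tendsto_measure_of_isClopen tendsto_id hA
  have hcluster : MapClusterPt (Φ μ) l (Φ ∘ ν) := hμ.continuousAt_comp hΦ
  exact hC.mem_of_mapClusterPt hcluster h

section Empirical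

variable {X : Type*} [MeasurableSpace X] {T : X → X} {x : X} {n : ℕ} {hn : n ≠ 0}

lemma empiricalMeasure_apply {A : Set X} [DecidablePred (· ∈ A)] (hA : MeasurableSet A) :
    (empiricalMeasure T x n hn : Measure X) A = Nat.count (fun i => T^[i] x ∈ A) n / n := by
  change ((n : ℝ≥0∞)⁻¹ • ∑ i ∈ Finset.range n, Measure.dirac (T^[i] x) : Measure X) A = _
  rw [Measure.smul_apply, Measure.finsetSum_apply, smul_eq_mul, ENNReal.div_eq_inv_mul,
    Nat.count_eq_card_filter_range, Finset.card_filter, Nat.cast_sum]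
  congr! 2 with i
  simp [Measure.dirac_apply' _ hA, Set.indicator_apply]

lemma empiricalMeasure_apply_le_inv_iff {A : Set X} [DecidablePred (· ∈ A)] (hA : MeasurableSet A)
    {j : ℕ} : (empiricalMeasure T x n hn : Measure X) A ≤ (j : ℝ≥0∞)⁻¹ ↔
      j * Nat.count (fun i => T^[i] x ∈ A) n ≤ n := by
  rw [empiricalMeasure_apply hA, ENNReal.le_inv_iff_mul_le, mul_comm, ← mul_div_assoc,
    ENNReal.div_le_iff (by simpa using hn) (by simp), one_mul]
  norm_cast

lemma inv_le_empiricalMeasure_apply_iff {A : Set X} [DecidablePred (· ∈ A)] (hA : MeasurableSet A)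
    {q : ℕ} : (q : ℝ≥0∞)⁻¹ ≤ (empiricalMeasure T x n hn : Measure X) A ↔
      n ≤ q * Nat.count (fun i => T^[i] x ∈ A) n := by
  rw [empiricalMeasure_apply hA, ENNReal.inv_le_iff_le_mul (by simp [ENNReal.div_eq_top, hn])
    (by simp), ← mul_div_assoc, ENNReal.le_div_iff_mul_le (by simp [hn]) (by simp), one_mul]
  norm_cast

lemma mem_invariantMeasures_of_map_eq {μ : ProbabilityMeasure X} (hT : Measurable T)
    (hμ : Measure.map T (μ : Measure X) = μ) : μ ∈ invariantMeasures T := by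
  intro A hA
  have hpreimage : (μ : Measure X) (T ⁻¹' A) = (μ : Measure X) A := by
    rw [← Measure.map_apply hT hA, hμ]
  exact congrArg ENNReal.toNNReal hpreimage

variable [TopologicalSpace X]

lemma integral_empiricalMeasure [OpensMeasurableSpace X] (f : BoundedContinuousFunction X ℝ) :
    ∫ y, f y ∂(empiricalMeasure T x n hn : Measure X) =
      (∑ i ∈ Finset.range n, f (T^[i] x)) / n := by
  change ∫ y, f y ∂((n : ℝ≥0∞)⁻¹ • ∑ i ∈ Finset.range n, Measure.dirac (T^[i] x) : Measure X) = _
  rw [integral_smul_measure, integral_finsetSum_measure fun i _ => f.integrable _]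
  simp only [integral_dirac' _ _ f.continuous.stronglyMeasurable]
  simp [div_eq_inv_mul]

lemma continuous_empiricalMeasure [OpensMeasurableSpace X] (hT : Continuous T) (n : ℕ)
    (hn : n ≠ 0) : Continuous fun x => empiricalMeasure T x n hn := by
  refine continuous_iff_continuousAt.2 fun x =>
    ProbabilityMeasure.tendsto_iff_forall_integral_tendsto.2 fun f => ?_
  simp only [integral_empiricalMeasure]
  have hcont : Continuous fun x => (∑ i ∈ Finset.range n, f (T^[i] x)) / n :=
    (continuous_finsetSum _ fun i _ => f.continuous.comp (hT.iterate i)).div_const _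
  exact hcont.tendsto x

lemma isGδ_setOf_mem_limitMeasures [OpensMeasurableSpace X]
    [FirstCountableTopology (ProbabilityMeasure X)] (hT : Continuous T)
    (μ : ProbabilityMeasure X) : IsGδ {x | μ ∈ limitMeasures T x} := by
  obtain ⟨U, hU, hbasis⟩ := (nhds_basis_opens μ).exists_antitone_subbasis
  have heq : {x | μ ∈ limitMeasures T x} = ⋂ m, ⋂ k, ⋃ n ≥ k,
      {x | empiricalMeasure T x (n + 1) n.succ_ne_zero ∈ U m} := by
    ext x
    simp [limitMeasures, hbasis.mapClusterPt_iff_frequently, frequently_atTop]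
  rw [heq]
  refine .iInter fun m => .iInter fun k => IsOpen.isGδ ?_
  exact isOpen_biUnion fun n _ => (hU m).2.preimage (continuous_empiricalMeasure hT _ _)

lemma abs_integral_comp_sub_integral_empiricalMeasure_le [OpensMeasurableSpace X]
    (hT : Continuous T) (f : BoundedContinuousFunction X ℝ) :
    |∫ y, f (T y) ∂(empiricalMeasure T x n hn : Measure X) -
      ∫ y, f y ∂(empiricalMeasure T x n hn : Measure X)| ≤ 2 * ‖f‖ / n := by
  have hcomp := integral_empiricalMeasure (x := x) (hn := hn) (T := T) (f.compContinuous ⟨T, hT⟩)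
  simp only [BoundedContinuousFunction.compContinuous_apply, ContinuousMap.coe_mk,
    ← Function.iterate_succ_apply' T] at hcomp
  rw [hcomp, integral_empiricalMeasure, ← sub_div, ← Finset.sum_sub_distrib,
    Finset.sum_range_sub (fun i => f (T^[i] x)), abs_div, Nat.abs_cast, two_mul]
  gcongr
  exact (norm_sub_le _ _).trans (add_le_add (f.norm_coe_le_norm _) (f.norm_coe_le_norm _))

lemma integral_comp_eq_of_mem_limitMeasures [OpensMeasurableSpace X] (hT : Continuous T)
    {μ : ProbabilityMeasure X} (hμ : μ ∈ limitMeasures T x) (f : BoundedContinuousFunction X ℝ) :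
    ∫ y, f (T y) ∂(μ : Measure X) = ∫ y, f y ∂(μ : Measure X) := by
  let Φ : ProbabilityMeasure X → ℝ := fun ν =>
    ∫ y, f (T y) ∂(ν : Measure X) - ∫ y, f y ∂(ν : Measure X)
  have hΦ : Continuous Φ :=
    (ProbabilityMeasure.continuous_integral_boundedContinuousFunction
      (f.compContinuous ⟨T, hT⟩)).sub
      (ProbabilityMeasure.continuous_integral_boundedContinuousFunction f)
  have hlim : Tendsto (fun n : ℕ => Φ (empiricalMeasure T x (n + 1) n.succ_ne_zero)) atTop
      (𝓝 0) :=
    squeeze_zero_norm (fun n => abs_integral_comp_sub_integral_empiricalMeasure_le hT f)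
      ((tendsto_const_nhds.div_atTop tendsto_natCast_atTop_atTop).comp (tendsto_add_atTop_nat 1))
  have hcluster := hμ.continuousAt_comp hΦ.continuousAt
  have : (𝓝 (Φ μ) ⊓ 𝓝 0).NeBot := hcluster.neBot.mono (inf_le_inf_left _ hlim)
  exact sub_eq_zero.1 (eq_of_nhds_neBot this)

lemma limitMeasures_subset_invariantMeasures [BorelSpace X] [HasOuterApproxClosed X]
    (hT : Continuous T) (x : X) : limitMeasures T x ⊆ invariantMeasures T := by
  intro μ hμ
  have := Measure.isFiniteMeasure_map (μ : Measure X) T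
  refine mem_invariantMeasures_of_map_eq hT.measurable <|
    ext_of_forall_integral_eq_of_IsFiniteMeasure fun f => ?_
  rw [integral_map hT.aemeasurable f.continuous.aestronglyMeasurable,
    integral_comp_eq_of_mem_limitMeasures hT hμ]

end Empirical

/-! ### The shift on Baire space -/

lemma continuous_shift : Continuous shift :=
  continuous_pi fun n => continuous_apply (n + 1)

lemma iterate_shift_apply (x : ℕ → ℕ) (i n : ℕ) : shift^[i] x n = x (n + i) := by
  induction i generalizing x with
  | zero => rfl
  | succ i ih =>
    rw [Function.iterate_succ_apply, ih]
    rfl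

lemma isClopen_setOf_lt_apply (g i : ℕ) : IsClopen {y : ℕ → ℕ | g < y i} :=
  (isClopen_discrete (Set.Ioi g)).preimage (continuous_apply i)

lemma measurableSet_setOf_lt_apply (g i : ℕ) : MeasurableSet {y : ℕ → ℕ | g < y i} :=
  (isClopen_setOf_lt_apply g i).isOpen.measurableSet

lemma tendsto_measure_setOf_lt_apply (μ : Measure (ℕ → ℕ)) [IsFiniteMeasure μ] (i : ℕ) :
    Tendsto (fun g => μ {y | g < y i}) atTop (𝓝 0) := by
  have hempty : ⋂ g, {y : ℕ → ℕ | g < y i} = ∅ :=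
    Set.eq_empty_of_forall_notMem fun y hy =>
      lt_irrefl (y i) (Set.mem_iInter.1 hy (y i))
  rw [← measure_empty (μ := μ), ← hempty]
  exact tendsto_measure_iInter_atTop
    (fun g => (measurableSet_setOf_lt_apply g i).nullMeasurableSet)
    (fun g h hgh y hy => hgh.trans_lt hy) ⟨0, measure_ne_top _ _⟩

lemma deltaZero_mem_invariantMeasures : deltaZero ∈ invariantMeasures shift :=
  mem_invariantMeasures_of_map_eq continuous_shift.measurable
    (Measure.map_dirac' continuous_shift.measurable _)

lemma deltaZero_setOf_pos : (deltaZero : Measure (ℕ → ℕ)) {y | 0 < y 0} = 0 := by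
  change Measure.dirac _ _ = 0
  simp [Measure.dirac_apply' _ (measurableSet_setOf_lt_apply 0 0)]

lemma measure_setOf_lt_apply_of_mem_invariantMeasures {μ : ProbabilityMeasure (ℕ → ℕ)}
    (hμ : μ ∈ invariantMeasures shift) (g i : ℕ) :
    (μ : Measure (ℕ → ℕ)) {y | g < y i} = (μ : Measure (ℕ → ℕ)) {y | g < y 0} := by
  induction i with
  | zero => rfl
  | succ i ih =>
    rw [← ih]
    have hinv := hμ _ (measurableSet_setOf_lt_apply g i)
    simpa [← ENNReal.coe_inj, Set.preimage_ofPred_eq, shift] using hinv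

lemma eq_deltaZero_of_mem_invariantMeasures {μ : ProbabilityMeasure (ℕ → ℕ)}
    (hμ : μ ∈ invariantMeasures shift) (h₀ : (μ : Measure (ℕ → ℕ)) {y | 0 < y 0} = 0) :
    μ = deltaZero := by
  have hae : id =ᵐ[(μ : Measure (ℕ → ℕ))] fun _ _ => 0 := by
    have hcoord : ∀ᵐ y ∂(μ : Measure (ℕ → ℕ)), ∀ i, y i = 0 := by
      refine ae_all_iff.2 fun i => ?_
      simpa [ae_iff, Nat.pos_iff_ne_zero] using
        (measure_setOf_lt_apply_of_mem_invariantMeasures hμ 0 i).trans h₀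
    filter_upwards [hcoord] with y hy using funext hy
  have hmap : (μ : Measure (ℕ → ℕ)).map id = (μ : Measure (ℕ → ℕ)).map fun _ _ => 0 :=
    Measure.map_congr hae
  rw [Measure.map_id, Measure.map_const, measure_univ, one_smul] at hmap
  exact Subtype.ext hmap

section EmpiricalShift

variable {x : ℕ → ℕ} {n : ℕ} {hn : n ≠ 0}

lemma empiricalMeasure_shift_le_inv_iff {g j : ℕ} :
    (empiricalMeasure shift x n hn : Measure (ℕ → ℕ)) {y | g < y 0} ≤ (j : ℝ≥0∞)⁻¹ ↔
      j * exceedances g x n ≤ n := by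
  classical
  rw [empiricalMeasure_apply_le_inv_iff (measurableSet_setOf_lt_apply g 0)]
  simp [iterate_shift_apply, exceedances]

lemma inv_le_empiricalMeasure_shift_iff {g q : ℕ} :
    (q : ℝ≥0∞)⁻¹ ≤ (empiricalMeasure shift x n hn : Measure (ℕ → ℕ)) {y | g < y 0} ↔
      n ≤ q * exceedances g x n := by
  classical
  rw [inv_le_empiricalMeasure_apply_iff (measurableSet_setOf_lt_apply g 0)]
  simp [iterate_shift_apply, exceedances]

lemma count_lt_apply_add_le (g : ℕ) (x : ℕ → ℕ) (i n : ℕ) :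
    Nat.count (fun k => g < x (i + k)) n ≤ exceedances g x n + i := by
  calc Nat.count (fun k => g < x (i + k)) n ≤ exceedances g x (i + n) := by
        rw [exceedances_add]
        exact Nat.le_add_left _ _
    _ ≤ exceedances g x n + i := by
        rw [add_comm i, exceedances_add]
        exact Nat.add_le_add_left (Nat.count_le _) _

lemma map_eval_empiricalMeasure_shift_le_inv {g i j : ℕ}
    (h : j * (exceedances g x n + i) ≤ n) :
    (empiricalMeasure shift x n hn : Measure (ℕ → ℕ)).map (Function.eval i) (Set.Iic g)ᶜ ≤
      (j : ℝ≥0∞)⁻¹ := by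
  classical
  rw [Set.compl_Iic, Measure.map_apply (measurable_pi_apply i) measurableSet_Ioi]
  refine (empiricalMeasure_apply_le_inv_iff (measurableSet_setOf_lt_apply g i)).2 ?_
  simp only [Set.mem_ofPred_eq, iterate_shift_apply]
  exact (Nat.mul_le_mul_left j (count_lt_apply_add_le g x i n)).trans h

end EmpiricalShift

section LimitMeasures

variable {x : ℕ → ℕ} {M : ℕ → ℕ}

lemma isTightMeasureSet_range_map_eval_empiricalMeasure (hM : Tendsto M atTop atTop)
    (htight : IsTightAlong x M) (i : ℕ) :
    IsTightMeasureSet (Set.range fun k =>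
      (empiricalMeasure shift x (M k + 1) (M k).succ_ne_zero : Measure (ℕ → ℕ)).map
        (Function.eval i)) := by
  refine isTightMeasureSet_range_of_eventually_cofinite (fun k => ?_) fun ε hε => ?_
  · have := Measure.isFiniteMeasure_map
      (empiricalMeasure shift x (M k + 1) (M k).succ_ne_zero : Measure (ℕ → ℕ))
      (Function.eval i)
    exact isTightMeasureSet_singleton
  · obtain ⟨j, hj⟩ := ENNReal.exists_inv_nat_lt hε.ne'
    obtain ⟨g, hg⟩ := htight (2 * j)
    refine ⟨Set.Iic g, (Set.finite_Iic g).isCompact, ?_⟩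
    rw [Nat.cofinite_eq_atTop]
    filter_upwards [hg, hM.eventually_ge_atTop (2 * j * i)] with k hgk hik
    exact (map_eval_empiricalMeasure_shift_le_inv (by lia)).trans hj.le

lemma exists_mem_limitMeasures_mapClusterPt (hM : Tendsto M atTop atTop)
    (htight : IsTightAlong x M) :
    ∃ μ ∈ limitMeasures shift x, MapClusterPt μ atTop fun k =>
      empiricalMeasure shift x (M k + 1) (M k).succ_ne_zero := by
  set ν := fun k => empiricalMeasure shift x (M k + 1) (M k).succ_ne_zero
  have hν : IsTightMeasureSet {((μ : ProbabilityMeasure (ℕ → ℕ)) : Measure (ℕ → ℕ)) |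
      μ ∈ Set.range ν} := by
    refine isTightMeasureSet_pi fun i => ?_
    refine (isTightMeasureSet_range_map_eval_empiricalMeasure hM htight i).subset ?_
    rintro _ ⟨_, ⟨_, ⟨k, rfl⟩, rfl⟩, rfl⟩
    exact ⟨k, rfl⟩
  obtain ⟨μ, -, hμ⟩ := (isCompact_closure_of_isTightMeasureSet hν).exists_mapClusterPt
    (f := atTop) (u := ν) (tendsto_principal.2 (.of_forall fun k => subset_closure ⟨k, rfl⟩))
  exact ⟨μ, MapClusterPt.of_comp hM hμ, hμ⟩

lemma exists_mem_limitMeasures_ne_deltaZero (hx : TightNonzero x) :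
    ∃ μ ∈ limitMeasures shift x, μ ≠ deltaZero := by
  obtain ⟨M, hM, htight, q, hq⟩ := hx
  obtain ⟨μ, hμ, hcluster⟩ := exists_mem_limitMeasures_mapClusterPt hM htight
  refine ⟨μ, hμ, ?_⟩
  rintro rfl
  have hle : (q : ℝ≥0∞)⁻¹ ≤ (deltaZero : Measure (ℕ → ℕ)) {y | 0 < y 0} :=
    measure_mem_of_mapClusterPt hcluster (isClopen_setOf_lt_apply 0 0) isClosed_Ici
      (hq.mono fun _ => inv_le_empiricalMeasure_shift_iff.2)
  simp [deltaZero_setOf_pos] at hle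

lemma tightNonzero_of_mem_limitMeasures {μ : ProbabilityMeasure (ℕ → ℕ)}
    (hμ : μ ∈ limitMeasures shift x) (hne : μ ≠ deltaZero) : TightNonzero x := by
  obtain ⟨M, hM, hlim⟩ := MapClusterPt.tendsto_subseq hμ
  have htendsto (g : ℕ) : Tendsto
      (fun k => (empiricalMeasure shift x (M k + 1) (M k).succ_ne_zero : Measure (ℕ → ℕ))
        {y | g < y 0}) atTop (𝓝 ((μ : Measure (ℕ → ℕ)) {y | g < y 0})) :=
    tendsto_measure_of_isClopen hlim (isClopen_setOf_lt_apply g 0)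
  refine ⟨M, hM.tendsto_atTop, fun j => ?_, ?_⟩
  · have hinv : (0 : ℝ≥0∞) < (j : ℝ≥0∞)⁻¹ := by simp
    obtain ⟨g, hg⟩ :=
      ((tendsto_measure_setOf_lt_apply (μ : Measure (ℕ → ℕ)) 0).eventually_lt_const hinv).exists
    exact ⟨g, ((htendsto g).eventually_lt_const hg).mono fun _ hk =>
      empiricalMeasure_shift_le_inv_iff.1 hk.le⟩
  · have hinv := limitMeasures_subset_invariantMeasures continuous_shift x hμ
    have hpos : (μ : Measure (ℕ → ℕ)) {y | 0 < y 0} ≠ 0 := fun h =>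
      hne (eq_deltaZero_of_mem_invariantMeasures hinv h)
    obtain ⟨q, hq⟩ := ENNReal.exists_inv_nat_lt hpos
    exact ⟨q, ((htendsto 0).eventually_const_lt hq).mono fun _ hk =>
      inv_le_empiricalMeasure_shift_iff.1 hk.le⟩

lemma tightNonzero_iff_exists_mem_limitMeasures :
    TightNonzero x ↔ ∃ μ ∈ limitMeasures shift x, μ ≠ deltaZero :=
  ⟨exists_mem_limitMeasures_ne_deltaZero, fun ⟨_, hμ, hne⟩ =>
    tightNonzero_of_mem_limitMeasures hμ hne⟩

lemma deltaZero_mem_limitMeasures (hM : Tendsto M atTop atTop)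
    (h : ∀ j, ∀ᶠ k in atTop, j * exceedances 0 x (M k + 1) ≤ M k + 1) :
    deltaZero ∈ limitMeasures shift x := by
  obtain ⟨μ, hμ, hcluster⟩ := exists_mem_limitMeasures_mapClusterPt hM fun j => ⟨0, h j⟩
  have hle (j : ℕ) : (μ : Measure (ℕ → ℕ)) {y | 0 < y 0} ≤ (j : ℝ≥0∞)⁻¹ :=
    measure_mem_of_mapClusterPt hcluster (isClopen_setOf_lt_apply 0 0) isClosed_Iic
      ((h j).mono fun _ => empiricalMeasure_shift_le_inv_iff.2)
  have hzero : (μ : Measure (ℕ → ℕ)) {y | 0 < y 0} = 0 := by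
    by_contra hne
    obtain ⟨j, hj⟩ := ENNReal.exists_inv_nat_lt hne
    exact (hle j).not_gt hj
  have hinv := limitMeasures_subset_invariantMeasures continuous_shift x hμ
  rwa [← eq_deltaZero_of_mem_invariantMeasures hinv hzero]

end LimitMeasures

lemma deltaZero_mem_limitMeasures_treePoint (T : Descriptive.tree ℕ) :
    deltaZero ∈ limitMeasures shift (treePoint T) := by
  refine deltaZero_mem_limitMeasures factorial_tendsto_atTop fun j => ?_
  filter_upwards [eventually_ge_atTop (3 * j + 1)] with n hn
  have hle := exceedances_treePoint_le (T := T) (n := n) (r := 1)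
    ((Nat.factorial_lt (by lia)).2 n.lt_succ_self) 0
  have hfactorial : (3 * j + 1) * (n - 1)! ≤ n ! := by
    rw [← Nat.mul_factorial_pred (by lia : n ≠ 0)]
    exact Nat.mul_le_mul_right _ hn
  have hmul := Nat.mul_le_mul_left j (hle.trans (Nat.add_le_add_left (min_le_left 1 n !) _))
  nlinarith [(n - 1).factorial_pos]

lemma hitG_shift_eq :
    hitG shift (invariantMeasures shift \ {deltaZero}) = {x | TightNonzero x} := by
  ext x
  refine Iff.trans ?_ tightNonzero_iff_exists_mem_limitMeasures.symm
  refine exists_congr fun μ => and_congr_right fun hμ => ?_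
  simp [limitMeasures_subset_invariantMeasures continuous_shift x hμ]

lemma lowerG_shift_eq : lowerG shift {deltaZero} = {x | ¬ TightNonzero x} := by
  ext x
  simp [lowerG, tightNonzero_iff_exists_mem_limitMeasures, Set.subset_def]

lemma measurable_exceedances (g n : ℕ) : Measurable fun x => exceedances g x n := by
  simp only [exceedances, Nat.count_eq_card_filter_range, Finset.card_filter]
  exact Finset.measurable_fun_sum _ fun i _ =>
    Measurable.ite (measurableSet_setOf_lt_apply g i) measurable_const measurable_const

lemma measurable_exceedances_apply (g k : ℕ) :
    Measurable fun p : (ℕ → ℕ) × (ℕ → ℕ) => exceedances g p.1 (p.2 k + 1) := by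
  have hexceedances : Measurable fun p : (ℕ → ℕ) × ℕ => exceedances g p.1 (p.2 + 1) :=
    measurable_from_prod_countable_left fun n => measurable_exceedances g (n + 1)
  exact hexceedances.comp (measurable_fst.prodMk ((measurable_pi_apply k).comp measurable_snd))

lemma measurableSet_setOf_eventually_atTop {X : Type*} [MeasurableSpace X] {p : ℕ → X → Prop}
    (hp : ∀ k, MeasurableSet {x | p k x}) : MeasurableSet {x | ∀ᶠ k in atTop, p k x} := by
  simp only [eventually_atTop, Set.ofPred_exists, Set.ofPred_forall]
  exact .iUnion fun a => .iInter fun k => .iInter fun _ => hp k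

lemma analyticSet_setOf_tightNonzero : AnalyticSet {x | TightNonzero x} := by
  have htime (k : ℕ) : Measurable fun p : (ℕ → ℕ) × (ℕ → ℕ) => p.2 k :=
    (measurable_pi_apply k).comp measurable_snd
  have htop : MeasurableSet {p : (ℕ → ℕ) × (ℕ → ℕ) | Tendsto p.2 atTop atTop} :=
    measurableSet_tendsto atTop htime
  have htight : MeasurableSet {p : (ℕ → ℕ) × (ℕ → ℕ) | IsTightAlong p.1 p.2} := by
    simp only [IsTightAlong, Set.ofPred_forall, Set.ofPred_exists]
    exact .iInter fun j => .iUnion fun g => measurableSet_setOf_eventually_atTop fun k =>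
      measurableSet_le ((measurable_exceedances_apply g k).const_mul j) ((htime k).add_const 1)
  have hnonzero : MeasurableSet {p : (ℕ → ℕ) × (ℕ → ℕ) |
      ∃ q, ∀ᶠ k in atTop, p.2 k + 1 ≤ q * exceedances 0 p.1 (p.2 k + 1)} := by
    simp only [Set.ofPred_exists]
    exact .iUnion fun q => measurableSet_setOf_eventually_atTop fun k =>
      measurableSet_le ((htime k).add_const 1) ((measurable_exceedances_apply 0 k).const_mul q)
  convert! (htop.inter (htight.inter hnonzero)).analyticSet.image_of_continuous continuous_fst
  ext x
  simp [TightNonzero]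

/-! ### The specification property of the shift -/

lemma sum_Iio_add_le {ι : Type*} [LinearOrder ι] [LocallyFiniteOrderBot ι] (l : ι → ℕ) {i j : ι}
    (hij : i < j) : (∑ m ∈ Finset.Iio i, l m) + l i ≤ ∑ m ∈ Finset.Iio j, l m := by
  rw [add_comm, ← Finset.sum_insert Finset.notMem_Iio_self, Finset.Iio_insert]
  exact Finset.sum_le_sum_of_subset fun m hm =>
    Finset.mem_Iio.2 ((Finset.mem_Iic.1 hm).trans_lt hij)

lemma sum_Iio_add_injective {ι : Type*} [LinearOrder ι] [LocallyFiniteOrderBot ι] (l : ι → ℕ) :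
    Function.Injective fun p : Σ j, Fin (l j) => (∑ i ∈ Finset.Iio p.1, l i) + p.2 := by
  rintro ⟨i, s⟩ ⟨j, t⟩ (heq : (∑ m ∈ Finset.Iio i, l m) + s = (∑ m ∈ Finset.Iio j, l m) + t)
  obtain hlt | rfl | hlt := lt_trichotomy i j
  · have hle := sum_Iio_add_le l hlt
    lia
  · rw [Fin.ext (Nat.add_left_cancel heq)]
  · have hle := sum_Iio_add_le l hlt
    lia

lemma exists_concatenation {ι A : Type*} [LinearOrder ι] [LocallyFiniteOrderBot ι] [Nonempty A]
    (x : ι → ℕ → A) (l : ι → ℕ) :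
    ∃ y : ℕ → A, ∀ j, ∀ t < l j, y ((∑ i ∈ Finset.Iio j, l i) + t) = x j t :=
  ⟨Function.extend (fun p : Σ j, Fin (l j) => (∑ i ∈ Finset.Iio p.1, l i) + p.2)
    (fun p => x p.1 p.2) fun _ => Classical.arbitrary A,
    fun j t ht => (sum_Iio_add_injective l).extend_apply _ _ ⟨j, t, ht⟩⟩

lemma specificationProperty_shift : @SpecificationProperty (ℕ → ℕ) baireMetric shift := by
  intro ε hε
  obtain ⟨m, hm⟩ := exists_pow_lt_of_lt_one hε (show (1 / 2 : ℝ) < 1 by norm_num)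
  refine ⟨m, fun k _ x n _ => ?_⟩
  obtain ⟨y, hy⟩ := exists_concatenation x fun j => n j + m
  refine ⟨y, fun _ => m, fun _ => le_rfl, fun j t ht => ?_⟩
  refine lt_of_le_of_lt ?_ hm
  refine PiNat.mem_cylinder_iff_dist_le.1 (PiNat.mem_cylinder_iff.2 fun i hi => ?_)
  rw [iterate_shift_apply, iterate_shift_apply, ← hy j (i + t) (by lia)]
  congr 1
  ring

/-! ### Completeness -/

lemma exists_reduction {Y : Type*} [TopologicalSpace Y] [SecondCountableTopology Y] [T0Space Y]
    (hY : IsTopologicalBasis {s : Set Y | IsClopen s}) {B : Set Y} (hB : AnalyticSet B) :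
    ∃ f : Y → ℕ → ℕ, Continuous f ∧ (∀ y, TightNonzero (f y) ↔ y ∈ B) ∧
      ∀ y, deltaZero ∈ limitMeasures shift (f y) := by
  obtain ⟨T, hT, hTB⟩ := exists_tree_hasBranch_iff_mem hY hB
  exact ⟨fun y => treePoint (T y), continuous_treePoint hT, fun y =>
    Iff.trans ⟨hasBranch_of_tightNonzero, tightNonzero_treePoint⟩ (hTB y),
    fun y => deltaZero_mem_limitMeasures_treePoint (T y)⟩

lemma isSigmaOneOneComplete_hitG :
    IsSigmaOneOneComplete (hitG shift (invariantMeasures shift \ {deltaZero})) := by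
  rw [hitG_shift_eq]
  refine ⟨analyticSet_setOf_tightNonzero, fun Y _ _ hY B hB => ?_⟩
  obtain ⟨f, hf, hfB, -⟩ := exists_reduction hY hB
  exact ⟨f, hf, Set.ext hfB⟩

lemma isPiOneOneComplete_lowerG : IsPiOneOneComplete (lowerG shift {deltaZero}) := by
  rw [lowerG_shift_eq]
  refine ⟨?_, fun Y _ _ hY B hB => ?_⟩
  · simpa only [CoanalyticSet, Set.compl_ofPred, not_not] using analyticSet_setOf_tightNonzero
  · obtain ⟨f, hf, hfB, -⟩ := exists_reduction hY hB
    exact ⟨f, hf, Set.ext fun y => by simp [hfB]⟩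

lemma measurableSet_upperG_deltaZero : MeasurableSet (upperG shift {deltaZero}) := by
  simpa only [upperG, Set.singleton_subset_iff] using
    (isGδ_setOf_mem_limitMeasures continuous_shift deltaZero).measurableSet

lemma isPiOneOneComplete_genericG : IsPiOneOneComplete (genericG shift {deltaZero}) := by
  refine ⟨?_, fun Y _ _ hY B hB => ?_⟩
  · rw [CoanalyticSet, genericG, Set.compl_inter, Set.union_eq_iUnion]
    refine AnalyticSet.iUnion fun b => ?_
    cases b
    · exact isPiOneOneComplete_lowerG.1
    · exact measurableSet_upperG_deltaZero.compl.analyticSet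
  · obtain ⟨f, hf, hfB, hf0⟩ := exists_reduction hY hB
    refine ⟨f, hf, Set.ext fun y => ?_⟩
    have hupper : f y ∈ upperG shift {deltaZero} := Set.singleton_subset_iff.2 (hf0 y)
    simp [genericG, hupper, lowerG_shift_eq, hfB]

end NonCompactGeneric

open NonCompactGeneric in
theorem mainTheorem3 :
    -- `(ω^ω, shift)` with the usual metric is a Polish dynamical system with specification
    PolishSpace (ℕ → ℕ) ∧ Continuous shift ∧
    baireMetric.toUniformSpace.toTopologicalSpace = Pi.topologicalSpace ∧
    @CompleteSpace (ℕ → ℕ) baireMetric.toUniformSpace ∧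
    @SpecificationProperty (ℕ → ℕ) baireMetric shift ∧
    -- `V = {δ}` is a closed connected nonempty set of invariant measures
    {deltaZero} ⊆ invariantMeasures shift ∧
    IsClosed ({deltaZero} : Set (ProbabilityMeasure (ℕ → ℕ))) ∧
    IsConnected ({deltaZero} : Set (ProbabilityMeasure (ℕ → ℕ))) ∧
    -- `G(V)` and `G_V` are complete coanalytic; hence not analytic, and not Borel
    IsPiOneOneComplete (genericG shift {deltaZero}) ∧
    ¬ AnalyticSet (genericG shift {deltaZero}) ∧
    ¬ MeasurableSet[borel (ℕ → ℕ)] (genericG shift {deltaZero}) ∧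
    IsPiOneOneComplete (lowerG shift {deltaZero}) ∧
    ¬ AnalyticSet (lowerG shift {deltaZero}) ∧
    ¬ MeasurableSet[borel (ℕ → ℕ)] (lowerG shift {deltaZero}) ∧
    -- `^U G` is complete analytic for `U = M_T \ {δ}`; hence not coanalytic, and not Borel
    IsSigmaOneOneComplete (hitG shift (invariantMeasures shift \ {deltaZero})) ∧
    ¬ CoanalyticSet (hitG shift (invariantMeasures shift \ {deltaZero})) ∧
    ¬ MeasurableSet[borel (ℕ → ℕ)]
      (hitG shift (invariantMeasures shift \ {deltaZero})) := by
  refine ⟨inferInstance, continuous_shift, rfl, ?_, specificationProperty_shift,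
    Set.singleton_subset_iff.2 deltaZero_mem_invariantMeasures, isClosed_singleton,
    isConnected_singleton, isPiOneOneComplete_genericG,
    isPiOneOneComplete_genericG.not_analyticSet, isPiOneOneComplete_genericG.not_measurableSet,
    isPiOneOneComplete_lowerG, isPiOneOneComplete_lowerG.not_analyticSet,
    isPiOneOneComplete_lowerG.not_measurableSet, isSigmaOneOneComplete_hitG,
    isSigmaOneOneComplete_hitG.not_coanalyticSet, isSigmaOneOneComplete_hitG.not_measurableSet⟩
  exact Pi.complete _
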